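/- Let $(\lambda_n)_{n\ge 1}$ be a sequence of non-zero complex numbers such that 1) $|\lambda_{n+1}|-|\lambda_n|\to+\infty$ as $n\to\infty$; 2) $\lambda_{n+1}/\lambda_n\to 1$ as $n\to\infty$; 3) $\liminf_{n\to\infty} n\left(\left|\lambda_{n+1}/\lambda_n\right|-1\right)>0$ (the value $+\infty$ being allowed). Let $r_0,R_0,\theta_0,\theta_T$ be real numbers with $0<r_0<1<R_0<+\infty$, $0\le\theta_0<\theta_T\le 1$ and $\theta_T-\theta_0=\frac14$, and let $$S=\{re^{2\pi i t} : r\in[r_0,R_0],\ t\in[\theta_0,\theta_T]\}.$$ Let $\mathcal H(\mathbb C)$ be the space of entire functions with the topology of local uniform convergence, let $T_b f(z)=f(z+b)$ for $b\in\mathbb C$, $f\in\mathcal H(\mathbb C)$, and for $a\in\mathbb C$ let $HC(\{T_{\lambda_n a}\})$ be the set of all $f\in\mathcal H(\mathbb C)$ for which $\{T_{\lambda_n a}f : n=1,2,\dots\}$ is dense in $\mathcal H(\mathbb C)$. Then $$\bigcap_{a\in S}HC(\{T_{\lambda_n a}\})$$ is a $G_\delta$ and dense subset of $\mathcal H(\mathbb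 C)$. -/

import Mathlib

open Filter Topology

/-- The linear subspace of entire functions in the space `C(ℂ, ℂ)`. The latter carries the
compact-open topology, i.e. the topology of uniform convergence on compact sets. -/
def entireSubmodule : Submodule ℂ C(ℂ, ℂ) where
  carrier := {f | Differentiable ℂ (f : ℂ → ℂ)}
  add_mem' hf hg := Differentiable.add hf hg
  zero_mem' := differentiable_const (0 : ℂ)
  smul_mem' c _ hf := Differentiable.const_smul hf c

/-- The space `H(ℂ)` of entire functions, with the topology of local uniform convergence
(the subspace topology inherited from `C(ℂ, ℂ)`). -/
abbrev EntireFunctions : Type := ↥entireSubmodule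

/-- The translation operator `T_a : H(ℂ) → H(ℂ)`, `(T_a f)(z) = f (z + a)`, a continuous linear
operator. -/
noncomputable def translationOp (a : ℂ) : EntireFunctions →L[ℂ] EntireFunctions where
  toFun f := ⟨f.1.comp ⟨fun z => z + a, by fun_prop⟩,
    Differentiable.comp (g := (f.1 : ℂ → ℂ)) f.2 (differentiable_id.add_const a)⟩
  map_add' _ _ := rfl
  map_smul' _ _ := rfl
  cont := Continuous.subtype_mk
    ((ContinuousMap.continuous_precomp _).comp continuous_subtype_val) _

/-- `(T_a f)(z) = f (z + a)`. -/
theorem translationOp_apply (a : ℂ) (f : EntireFunctions) (z : ℂ) :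
    (translationOp a f).1 z = f.1 (z + a) := rfl

/-- The set `HC({T_n})` of hypercyclic vectors of a sequence `(T_n)`, `n = 1, 2, …`, of continuous
linear operators on a topological vector space `X`: the vectors `x` whose orbit
`{T_n x : n = 1, 2, …}` is dense. (The term with index `0` plays no role.) -/
def HC {X : Type*} [AddCommMonoid X] [Module ℂ X] [TopologicalSpace X] (T : ℕ → X →L[ℂ] X) :
    Set X :=
  {x | Dense {y : X | ∃ n : ℕ, 1 ≤ n ∧ y = T n x}}

/-- The bounded sector `{r e^{2 π i t} : r ∈ [r₀, R₀], t ∈ [θ₀, θ_T]}`. -/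
def sector (r₀ R₀ θ₀ θT : ℝ) : Set ℂ :=
  {a | ∃ r ∈ Set.Icc r₀ R₀, ∃ t ∈ Set.Icc θ₀ θT,
    a = (r : ℂ) * Complex.exp (2 * (Real.pi : ℂ) * Complex.I * (t : ℂ))}

/-! The argument is a Baire category one. Over a countable basis of nonempty open sets `U`, the
intersection equals that of the sets `translatesMeet lam S U`. These are open because `S` is
compact, so it remains to show that each is dense (`dense_translatesMeet`).

For density, let `g₀` be the function to perturb and `g` a point of `U`. Suppose finitely many small
discs with centres `c i` cover `S`, the disc at `c i` being of radius `δ / ‖lam (n i)‖`, while the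
points `lam (n i) * c i` are far apart and far from `0`. An entire function close to `g₀` near `0`
and to the translate of `g` near each `lam (n i) * c i` then works: for `a` in the disc at `c i`,
`lam (n i) * a` is within `δ` of `lam (n i) * c i`, and `g` is uniformly continuous on compact sets.
Such a function comes from a Runge theorem for disjoint discs (`exists_entire_near_on_discs`).

The centres come from `exists_separated_covering_centres`. Blocks of `K * K` consecutive indices
serve successive thin annuli, and residues modulo `K` distribute the lattice points of an annulus
among the indices of its block. The liminf condition allows the `b`-th annulus a width comparable to
`1 / (b + 1)`; since the harmonic series diverges, the annuli exhaust `r ≤ ‖a‖`. -/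

/-! ### Runge approximation on separated discs -/

theorem isPreconnected_openAnnulus (c : ℂ) {r R : ℝ} (hr : 0 ≤ r) :
    IsPreconnected {z : ℂ | r < ‖z - c‖ ∧ ‖z - c‖ < R} := by
  have h : {z : ℂ | r < ‖z - c‖ ∧ ‖z - c‖ < R} =
      (fun p : ℝ × ℝ => c + (p.1 : ℂ) * Complex.exp (p.2 * Complex.I)) ''
        (Set.Ioo r R ×ˢ Set.univ) := by
    ext z
    constructor
    · rintro ⟨h1, h2⟩
      refine ⟨(‖z - c‖, Complex.arg (z - c)), ⟨⟨h1, h2⟩, trivial⟩, ?_⟩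
      simp [Complex.norm_mul_exp_arg_mul_I]
    · rintro ⟨⟨s, t⟩, ⟨⟨h1, h2⟩, -⟩, rfl⟩
      have : 0 < s := lt_of_le_of_lt hr h1
      simpa [Complex.norm_exp_ofReal_mul_I, abs_of_pos this] using ⟨h1, h2⟩
  rw [h]
  refine (isPreconnected_Ioo.prod isPreconnected_univ).image _ ?_
  fun_prop

section SeparatedDiscs

variable {ι : Type*} [Finite ι] {w : ι → ℂ} {ρ : ι → ℝ}

/-- Some annulus around each disc of a finite separated family misses the other discs. -/
theorem exists_annulus_disjoint (hsep : ∀ i j, i ≠ j → ρ i + ρ j < ‖w i - w j‖) (j : ι) :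
    ∃ η > 0, ∀ i, i ≠ j → ∀ z, ‖z - w i‖ ≤ ρ i → ρ j + η < ‖z - w j‖ := by
  have h1 : ∀ᶠ η : ℝ in 𝓝[>] 0, ∀ i, i ≠ j → ρ i + (ρ j + η) < ‖w i - w j‖ := by
    rw [eventually_all]
    intro i
    by_cases hij : i = j
    · simp [hij]
    have : ∀ᶠ η : ℝ in 𝓝 0, ρ i + (ρ j + η) < ‖w i - w j‖ := by
      refine ContinuousAt.eventually_lt (by fun_prop) (by fun_prop) ?_
      simpa using hsep i j hij
    exact (this.filter_mono nhdsWithin_le_nhds).mono fun η h _ => h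
  obtain ⟨η, h, hη⟩ := (h1.and self_mem_nhdsWithin).exists
  refine ⟨η, hη, fun i hij z hz => ?_⟩
  have h2 := h i hij
  have h3 : ‖w i - w j‖ ≤ ‖z - w i‖ + ‖z - w j‖ := by
    rw [norm_sub_rev z (w i)]
    simpa using norm_add_le (w i - z) (z - w j)
  linarith

/-- A compact set whose frontier lies in a finite union of separated discs lies in that union. -/
theorem subset_iUnion_closedBall_of_frontier_subset (hρ : ∀ i, 0 < ρ i)
    (hsep : ∀ i j, i ≠ j → ρ i + ρ j < ‖w i - w j‖) {σ : Set ℂ} (hσ : IsCompact σ)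
    (hfr : frontier σ ⊆ ⋃ i, Metric.closedBall (w i) (ρ i)) :
    σ ⊆ ⋃ i, Metric.closedBall (w i) (ρ i) := by
  set K := ⋃ i, Metric.closedBall (w i) (ρ i) with hK
  have hKc : IsClosed K := isClosed_iUnion_of_finite fun i => Metric.isClosed_closedBall
  by_contra hne
  obtain ⟨z₀, hz₀, hz₀K⟩ := Set.not_subset.1 hne
  have hZσ : closure (σ \ K) ⊆ σ := closure_minimal Set.sdiff_subset hσ.isClosed
  -- Extremal principle: a rightmost point of the closure of `σ \ K` is contradicted by a point of
  -- `σ \ K` further right.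
  obtain ⟨ζ, hζ, hmax⟩ := (hσ.of_isClosed_subset isClosed_closure hZσ).exists_isMaxOn
    ⟨z₀, subset_closure ⟨hz₀, hz₀K⟩⟩ Complex.continuous_re.continuousOn
  have hmax' : ∀ z ∈ σ \ K, z.re ≤ ζ.re := fun z hz => hmax (subset_closure hz)
  by_cases hζK : ζ ∈ K
  · obtain ⟨j, hj⟩ := Set.mem_iUnion.1 hζK
    rw [mem_closedBall_iff_norm] at hj
    obtain ⟨η, hη, hη'⟩ := exists_annulus_disjoint hsep j
    set A := {z : ℂ | ρ j < ‖z - w j‖ ∧ ‖z - w j‖ < ρ j + η} with hA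
    have hAK : Disjoint A K := by
      rw [Set.disjoint_left]
      rintro z ⟨hz1, hz2⟩ hzK
      obtain ⟨i, hi⟩ := Set.mem_iUnion.1 hzK
      rw [mem_closedBall_iff_norm] at hi
      by_cases hij : i = j
      · subst hij; linarith
      · linarith [hη' i hij z hi]
    obtain ⟨z, ⟨hzσ, hzK⟩, hzζ⟩ := Metric.mem_closure_iff.1 hζ η hη
    have hzA : z ∈ A := by
      refine ⟨?_, ?_⟩
      · by_contra h
        exact hzK (Set.mem_iUnion.2 ⟨j, mem_closedBall_iff_norm.2 (not_lt.1 h)⟩)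
      · rw [dist_comm, dist_eq_norm] at hzζ
        calc ‖z - w j‖ = ‖(z - ζ) + (ζ - w j)‖ := by ring_nf
          _ ≤ ‖z - ζ‖ + ‖ζ - w j‖ := norm_add_le _ _
          _ < ρ j + η := by linarith
    -- The annulus misses the frontier of `σ`, so `σ` is clopen in it; being connected and meeting
    -- `σ`, it lies in `σ`.
    have hAσ : A ⊆ σ := by
      by_contra h
      obtain ⟨y, hyA, hyσ⟩ := Set.not_subset.1 h
      have hint : ∀ y ∈ A, y ∈ σ → y ∈ interior σ := by
        intro y hy1 hy2
        by_contra hy3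
        exact Set.disjoint_left.1 hAK hy1 (hfr ⟨subset_closure hy2, hy3⟩)
      obtain ⟨y', -, hy1, hy2⟩ := isPreconnected_openAnnulus (w j) (hρ j).le
        (interior σ) σᶜ isOpen_interior hσ.isClosed.isOpen_compl
        (fun y hy => (em (y ∈ σ)).imp_left (hint y hy)) ⟨z, hzA, hint z hzA hzσ⟩ ⟨y, hyA, hyσ⟩
      exact hy2 (interior_subset hy1)
    have hy : w j + ((ρ j + η / 2 : ℝ) : ℂ) ∈ A := by
      have : 0 < ρ j + η / 2 := by have := hρ j; positivity
      simp only [hA, Set.mem_ofPred_eq, add_sub_cancel_left, Complex.norm_real, Real.norm_eq_abs,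
        abs_of_pos this]
      constructor <;> linarith
    have h1 := hmax' _ ⟨hAσ hy, Set.disjoint_left.1 hAK hy⟩
    have h2 := (Complex.re_le_norm (ζ - w j)).trans hj
    simp at h1 h2
    linarith
  · have hint : ζ ∈ interior σ := by
      by_contra h
      exact hζK (hfr ⟨subset_closure (hZσ hζ), h⟩)
    have hnhds : ∀ᶠ z in 𝓝 ζ, z ∈ σ \ K :=
      inter_mem (mem_interior_iff_mem_nhds.1 hint) (hKc.isOpen_compl.mem_nhds hζK)
    have ht : Tendsto (fun t : ℝ => ζ + (t : ℂ)) (𝓝[>] 0) (𝓝 ζ) := by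
      have : Continuous fun t : ℝ => ζ + (t : ℂ) := by fun_prop
      simpa using (this.tendsto 0).mono_left nhdsWithin_le_nhds
    obtain ⟨t, ht1, ht2⟩ := ((ht.eventually hnhds).and self_mem_nhdsWithin).exists
    have := hmax' _ ht1
    simp at this
    exact absurd ht2 (not_lt.2 this)

open Polynomial in
/-- The reciprocal of a polynomial without zeros on a finite union of separated discs is a uniform
limit of polynomials there. -/
theorem exists_polynomial_near_inv (hρ : ∀ i, 0 < ρ i)
    (hsep : ∀ i j, i ≠ j → ρ i + ρ j < ‖w i - w j‖) (p : ℂ[X])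
    (hp : ∀ i, ∀ z ∈ Metric.closedBall (w i) (ρ i), p.eval z ≠ 0) {ε : ℝ} (hε : 0 < ε) :
    ∃ q : ℂ[X], ∀ i, ∀ z ∈ Metric.closedBall (w i) (ρ i), ‖q.eval z - (p.eval z)⁻¹‖ < ε := by
  set K := ⋃ i, Metric.closedBall (w i) (ρ i) with hK
  have hKc : IsCompact K := isCompact_iUnion fun i => isCompact_closedBall _ _
  have : CompactSpace K := isCompact_iff_compactSpace.1 hKc
  let z : C(K, ℂ) := ⟨fun a => a, continuous_subtype_val⟩
  -- `S` is the uniform closure of the polynomials on `K`. Passing from `C(K, ℂ)` to `S` can only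
  -- fill holes of the spectrum `K` of `z`; the union of discs has none, so `p` stays invertible in
  -- `S`.
  let S := Algebra.elemental ℂ z
  have hS : IsClosed (S : Set C(K, ℂ)) := Algebra.elemental.isClosed ℂ z
  have : CompleteSpace S := hS.completeSpace_coe
  let x : S := ⟨z, Algebra.elemental.self_mem ℂ z⟩
  have hxz : spectrum ℂ (x : C(K, ℂ)) = K := by
    rw [ContinuousMap.spectrum_eq_range]
    exact Subtype.range_coe
  have hspec : spectrum ℂ x ⊆ K :=
    subset_iUnion_closedBall_of_frontier_subset hρ hsep (spectrum.isCompact x)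
      ((Subalgebra.frontier_spectrum S x).trans hxz.subset)
  have hunit : IsUnit (aeval x p) := by
    by_contra h
    have h0 : (0 : ℂ) ∈ spectrum ℂ (aeval x p) := spectrum.zero_mem ℂ h
    by_cases hc : 0 < p.degree
    · rw [spectrum.map_polynomial_aeval_of_degree_pos x p hc] at h0
      obtain ⟨ζ, hζ, hζ0⟩ := h0
      obtain ⟨i, hi⟩ := Set.mem_iUnion.1 (hspec hζ)
      exact hp i ζ hi hζ0
    -- The spectral mapping step needs positive degree. For the zero constant, either some disc
    -- contradicts `hp`, or the family is empty and `S` is trivial.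
    · rw [eq_C_of_degree_le_zero (not_lt.1 hc)] at h hp
      by_cases h00 : p.coeff 0 = 0
      · rcases isEmpty_or_nonempty ι with hι | ⟨⟨i⟩⟩
        · have : IsEmpty K := by rw [hK]; simp
          have : Subsingleton S := Subtype.coe_injective.subsingleton
          exact h (isUnit_of_subsingleton _)
        · exact hp i (w i) (Metric.mem_closedBall_self (hρ i).le) (by simp [h00])
      · apply h
        rw [aeval_C]
        exact (IsUnit.mk0 _ h00).map _
  obtain ⟨u, hu⟩ := hunit
  have hmem : ((↑u⁻¹ : S) : C(K, ℂ)) ∈ closure (Algebra.adjoin ℂ {z} : Set C(K, ℂ)) :=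
    (↑u⁻¹ : S).2
  obtain ⟨g, hg, hdist⟩ := Metric.mem_closure_iff.1 hmem ε hε
  rw [SetLike.mem_coe, Algebra.adjoin_singleton_eq_range_aeval] at hg
  obtain ⟨q, rfl⟩ := hg
  refine ⟨q, fun i y hy => ?_⟩
  let y' : K := ⟨y, Set.mem_iUnion.2 ⟨i, hy⟩⟩
  have heval : ∀ r : ℂ[X], (aeval z r) y' = r.eval y := by
    intro r
    simp [z, y']
  have hinv : ((↑u⁻¹ : S) : C(K, ℂ)) y' = (p.eval y)⁻¹ := by
    have h1 : ((aeval x p : S) : C(K, ℂ)) * ((↑u⁻¹ : S) : C(K, ℂ)) = 1 := by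
      rw [← hu]
      exact congrArg Subtype.val u.mul_inv
    have h2 : ((aeval x p : S) : C(K, ℂ)) = aeval z p :=
      (Polynomial.aeval_algHom_apply S.val x p).symm
    rw [h2] at h1
    have h3 := congrArg (fun f : C(K, ℂ) => f y') h1
    simp only [ContinuousMap.mul_apply, heval, ContinuousMap.one_apply] at h3
    exact eq_inv_of_mul_eq_one_right h3
  have := (ContinuousMap.dist_apply_le_dist y').trans_lt hdist
  rw [dist_comm, dist_eq_norm, hinv] at this
  have h4 := heval q
  change ‖(aeval z q) y' - _‖ < ε at this
  rwa [h4] at this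

open Polynomial in
/-- Polynomials approximate the indicator function of one of finitely many separated discs. -/
theorem exists_polynomial_near_indicator (hρ : ∀ i, 0 < ρ i)
    (hsep : ∀ i j, i ≠ j → ρ i + ρ j < ‖w i - w j‖) (j : ι) {ε : ℝ} (hε : 0 < ε) :
    ∃ q : ℂ[X], (∀ z ∈ Metric.closedBall (w j) (ρ j), ‖q.eval z - 1‖ < ε) ∧
      ∀ i, i ≠ j → ∀ z ∈ Metric.closedBall (w i) (ρ i), ‖q.eval z‖ < ε := by
  obtain ⟨η, hη, hη'⟩ := exists_annulus_disjoint hsep j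
  have hρj := hρ j
  -- With `τ` strictly between `ρ j` and `ρ j + η`, the power `((z - w j) / τ) ^ n` is tiny on disc
  -- `j` and huge on the others, so the reciprocal of one plus it is nearly the indicator.
  set τ := ρ j + η / 2 with hτ
  have hτ0 : 0 < τ := by positivity
  have hs : Tendsto (fun n : ℕ => (ρ j / τ) ^ n) atTop (𝓝 0) :=
    tendsto_pow_atTop_nhds_zero_of_lt_one (by positivity) (by rw [div_lt_one hτ0]; linarith)
  have hl : Tendsto (fun n : ℕ => ((ρ j + η) / τ) ^ n) atTop atTop :=
    tendsto_pow_atTop_atTop_of_one_lt (by rw [one_lt_div hτ0]; linarith)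
  obtain ⟨n, hn1, hn2⟩ := ((hs.eventually_lt_const
    (show (0 : ℝ) < min (1 / 2) (ε / 4) by positivity)).and
    (hl.eventually_gt_atTop (1 + 2 / ε))).exists
  set p : ℂ[X] := 1 + (C ((τ : ℂ)⁻¹) * (X - C (w j))) ^ n with hp
  have hpe : ∀ z, p.eval z = 1 + ((τ : ℂ)⁻¹ * (z - w j)) ^ n := by intro z; simp [hp]
  have hnorm : ∀ z, ‖((τ : ℂ)⁻¹ * (z - w j)) ^ n‖ = (‖z - w j‖ / τ) ^ n := by
    intro z
    rw [norm_pow, norm_mul, norm_inv, Complex.norm_real, Real.norm_eq_abs, abs_of_pos hτ0,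
      div_eq_inv_mul]
  have hin : ∀ z ∈ Metric.closedBall (w j) (ρ j),
      ‖((τ : ℂ)⁻¹ * (z - w j)) ^ n‖ < min (1 / 2) (ε / 4) := by
    intro z hz
    rw [mem_closedBall_iff_norm] at hz
    rw [hnorm]
    refine lt_of_le_of_lt ?_ hn1
    gcongr
  have hout : ∀ i, i ≠ j → ∀ z ∈ Metric.closedBall (w i) (ρ i),
      1 + 2 / ε < ‖((τ : ℂ)⁻¹ * (z - w j)) ^ n‖ := by
    intro i hij z hz
    rw [mem_closedBall_iff_norm] at hz
    rw [hnorm]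
    refine lt_of_lt_of_le hn2 ?_
    have := hη' i hij z hz
    gcongr
  have hp1 : ∀ z ∈ Metric.closedBall (w j) (ρ j), 1 / 2 < ‖p.eval z‖ := by
    intro z hz
    have h1 := lt_of_lt_of_le (hin z hz) (min_le_left _ _)
    have h2 := norm_sub_le_norm_add (1 : ℂ) (((τ : ℂ)⁻¹ * (z - w j)) ^ n)
    rw [hpe]
    rw [norm_one] at h2
    linarith
  have hp2 : ∀ i, i ≠ j → ∀ z ∈ Metric.closedBall (w i) (ρ i), 2 / ε < ‖p.eval z‖ := by
    intro i hij z hz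
    have h1 := hout i hij z hz
    have h2 := norm_sub_le_norm_add (((τ : ℂ)⁻¹ * (z - w j)) ^ n) (1 : ℂ)
    rw [hpe, add_comm]
    rw [norm_one] at h2
    linarith
  have hp0 : ∀ i, ∀ z ∈ Metric.closedBall (w i) (ρ i), p.eval z ≠ 0 := by
    intro i z hz
    rw [← norm_pos_iff]
    by_cases hij : i = j
    · subst hij; linarith [hp1 z hz]
    · exact lt_trans (by positivity) (hp2 i hij z hz)
  obtain ⟨q, hq⟩ := exists_polynomial_near_inv hρ hsep p hp0 (half_pos hε)
  refine ⟨q, fun z hz => ?_, fun i hij z hz => ?_⟩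
  · have h1 := hq j z hz
    have h2 : ‖(p.eval z)⁻¹ - 1‖ ≤ ε / 2 := by
      have h3 : (p.eval z)⁻¹ - 1 = -(((τ : ℂ)⁻¹ * (z - w j)) ^ n) / p.eval z := by
        have := hp0 j z hz
        field_simp
        rw [hpe]
        ring
      rw [h3, norm_div, norm_neg, div_le_iff₀ (norm_pos_iff.2 (hp0 j z hz))]
      have h4 := lt_of_lt_of_le (hin z hz) (min_le_right _ _)
      nlinarith [hp1 z hz]
    calc ‖q.eval z - 1‖ = ‖(q.eval z - (p.eval z)⁻¹) + ((p.eval z)⁻¹ - 1)‖ := by ring_nf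
      _ ≤ _ := norm_add_le _ _
      _ < ε := by linarith
  · have h1 := hq i z hz
    have h2 : ‖(p.eval z)⁻¹‖ < ε / 2 := by
      rw [norm_inv, show ε / 2 = (2 / ε)⁻¹ by field_simp]
      exact inv_strictAnti₀ (by positivity) (hp2 i hij z hz)
    calc ‖q.eval z‖ = ‖(q.eval z - (p.eval z)⁻¹) + (p.eval z)⁻¹‖ := by ring_nf
      _ ≤ _ := norm_add_le _ _
      _ < ε := by linarith

end SeparatedDiscs

/-- Entire functions given on finitely many separated discs are simultaneously approximated by a
single entire function. -/
theorem exists_entire_near_on_discs {ι : Type*} [Fintype ι] {w : ι → ℂ} {ρ : ι → ℝ}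
    (hρ : ∀ i, 0 < ρ i) (hsep : ∀ i j, i ≠ j → ρ i + ρ j < ‖w i - w j‖) (h : ι → ℂ → ℂ)
    (hd : ∀ i, Differentiable ℂ (h i)) {ε : ℝ} (hε : 0 < ε) :
    ∃ f : ℂ → ℂ, Differentiable ℂ f ∧
      ∀ i, ∀ z ∈ Metric.closedBall (w i) (ρ i), ‖f z - h i z‖ < ε := by
  classical
  have hb : ∀ j i, ∃ M : ℝ, ∀ z ∈ Metric.closedBall (w i) (ρ i), ‖h j z‖ ≤ M := fun j i =>
    (isCompact_closedBall (w i) (ρ i)).exists_bound_of_continuousOn (hd j).continuous.continuousOn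
  choose M hM using hb
  set B : ℝ := 1 + ∑ j, ∑ i, |M j i| with hB
  have hB0 : 0 < B := by positivity
  have hMB : ∀ j i, ∀ z ∈ Metric.closedBall (w i) (ρ i), ‖h j z‖ ≤ B := by
    intro j i z hz
    have h1 : |M j i| ≤ ∑ i, |M j i| :=
      Finset.single_le_sum (f := fun i => |M j i|) (fun _ _ => abs_nonneg _) (Finset.mem_univ i)
    have h2 : ∑ i, |M j i| ≤ ∑ j, ∑ i, |M j i| :=
      Finset.single_le_sum (f := fun j => ∑ i, |M j i|)
        (fun _ _ => Finset.sum_nonneg fun _ _ => abs_nonneg _) (Finset.mem_univ j)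
    linarith [hM j i z hz, le_abs_self (M j i)]
  set δ : ℝ := ε / (B * (Fintype.card ι + 1)) with hδ
  have hδ0 : 0 < δ := by positivity
  choose q hq1 hq2 using fun j => exists_polynomial_near_indicator hρ hsep j hδ0
  refine ⟨fun z => ∑ j, h j z * (q j).eval z, ?_, fun i z hz => ?_⟩
  · exact Differentiable.fun_sum fun j _ => (hd j).mul (q j).differentiable
  have hdec : ∑ j, h j z * (q j).eval z - h i z
      = ∑ j, h j z * ((q j).eval z - if j = i then 1 else 0) := by
    simp [mul_sub, Finset.sum_sub_distrib]
  have hterm : ∀ j, ‖h j z * ((q j).eval z - if j = i then 1 else 0)‖ ≤ B * δ := by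
    intro j
    rw [norm_mul]
    refine mul_le_mul (hMB j i z hz) ?_ (norm_nonneg _) hB0.le
    by_cases hji : j = i
    · subst hji
      simpa using (hq1 j z hz).le
    · simpa [hji] using (hq2 j i (Ne.symm hji) z hz).le
  calc ‖∑ j, h j z * (q j).eval z - h i z‖
      ≤ ∑ j : ι, B * δ := by rw [hdec]; exact norm_sum_le_of_le _ fun j _ => hterm j
    _ = Fintype.card ι * (B * δ) := by simp
    _ < (Fintype.card ι + 1) * (B * δ) := by
      have : 0 < B * δ := by positivity
      linarith
    _ = ε := by rw [hδ]; field_simp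

/-! ### Separated centres from lattices in thin annuli -/

/-- The lattice point `h (u + i v)`. -/
noncomputable def latticePoint (h : ℝ) (u v : ℤ) : ℂ := (h : ℂ) * ((u : ℂ) + (v : ℂ) * Complex.I)

theorem norm_sub_latticePoint_floor_lt {h : ℝ} (hh : 0 < h) (a : ℂ) :
    ‖a - latticePoint h ⌊a.re / h⌋ ⌊a.im / h⌋‖ < 2 * h := by
  have key : ∀ t : ℝ, |t - h * (⌊t / h⌋ : ℝ)| < h := by
    intro t
    have h1 : t - h * (⌊t / h⌋ : ℝ) = h * Int.fract (t / h) := by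
      rw [Int.fract]; field_simp
    rw [h1, abs_of_nonneg (mul_nonneg hh.le (Int.fract_nonneg _))]
    nlinarith [Int.fract_lt_one (t / h)]
  refine lt_of_le_of_lt (Complex.norm_le_abs_re_add_abs_im _) ?_
  have h1 := key a.re
  have h2 := key a.im
  simp only [latticePoint, Complex.sub_re, Complex.sub_im, Complex.mul_re, Complex.mul_im,
    Complex.add_re, Complex.add_im, Complex.ofReal_re, Complex.ofReal_im, Complex.intCast_re,
    Complex.intCast_im, Complex.I_re, Complex.I_im]
  ring_nf at h1 h2 ⊢
  linarith

theorem le_norm_latticePoint_sub {h : ℝ} (hh : 0 < h) {K : ℕ} {u v u' v' : ℤ}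
    (hu : u % K = u' % K) (hv : v % K = v' % K) (hne : u ≠ u' ∨ v ≠ v') :
    h * K ≤ ‖latticePoint h u v - latticePoint h u' v'‖ := by
  have key : ∀ s t : ℤ, s % K = t % K → s ≠ t → h * K ≤ |h * ((s : ℝ) - t)| := by
    intro s t hst hne
    have h1 : (K : ℤ) ≤ |s - t| := by
      apply Int.le_of_dvd (abs_pos.2 (sub_ne_zero.2 hne))
      rw [dvd_abs]
      exact Int.ModEq.dvd (Eq.symm hst)
    have h2 : (K : ℝ) ≤ |(s : ℝ) - t| := by exact_mod_cast h1
    rw [abs_mul, abs_of_pos hh]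
    gcongr
  rcases hne with hne | hne
  · refine (key u u' hu hne).trans ?_
    have := Complex.abs_re_le_norm (latticePoint h u v - latticePoint h u' v')
    simpa [latticePoint, ← mul_sub] using this
  · refine (key v v' hv hne).trans ?_
    have := Complex.abs_im_le_norm (latticePoint h u v - latticePoint h u' v')
    simpa [latticePoint, ← mul_sub] using this

/-- A number in `[0, K²)` encoding the residues of `u` and `v` modulo `K`. -/
def residueCode (K : ℕ) (u v : ℤ) : ℕ := (u % K).toNat + K * (v % K).toNat

theorem residueCode_lt {K : ℕ} (hK : 0 < K) (u v : ℤ) : residueCode K u v < K * K := by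
  have hu := Int.emod_lt_of_pos u (Int.natCast_pos.2 hK)
  have hv := Int.emod_lt_of_pos v (Int.natCast_pos.2 hK)
  have h1 : (u % K).toNat < K := by omega
  have h2 : (v % K).toNat + 1 ≤ K := by omega
  unfold residueCode
  nlinarith

theorem residueCode_inj {K : ℕ} (hK : 0 < K) {u v u' v' : ℤ}
    (h : residueCode K u v = residueCode K u' v') : u % K = u' % K ∧ v % K = v' % K := by
  have hu := Int.emod_lt_of_pos u (Int.natCast_pos.2 hK)
  have hu' := Int.emod_lt_of_pos u' (Int.natCast_pos.2 hK)
  have k0 : (K : ℤ) ≠ 0 := by omega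
  have hu0 := Int.emod_nonneg u k0
  have hu0' := Int.emod_nonneg u' k0
  have hv0 := Int.emod_nonneg v k0
  have hv0' := Int.emod_nonneg v' k0
  have h1 : (u % K).toNat < K := by omega
  have h1' : (u' % K).toNat < K := by omega
  unfold residueCode at h
  have e1 := congrArg (· % K) h
  have e2 := congrArg (· / K) h
  simp only [Nat.add_mul_mod_self_left, Nat.mod_eq_of_lt h1, Nat.mod_eq_of_lt h1'] at e1
  simp only [Nat.add_mul_div_left _ _ hK, Nat.div_eq_of_lt h1, Nat.div_eq_of_lt h1'] at e2
  constructor <;> omega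

/-- Two centres with the same index have congruent lattice coordinates, hence are `K` meshes apart.
For different indices the moduli of the products separate: `hgap` beats the loss from mesh and
annulus width. `hdouble` lets one mesh serve a whole block. -/
theorem exists_separated_covering_centres_of_forall {μ : ℕ → ℂ} {K N : ℕ} {M c r D δ C : ℝ}
    (hK : 0 < K) (hN : 0 < N) (hc : 0 < c) (hr : 0 < r) (hδ : 0 < δ) (hM : 0 < M)
    (hKD : 4 * D ≤ δ * K) (hMD : 2 * (D + 2 * δ) ≤ r * M) (hC : C + δ ≤ ‖μ 0‖ * r)
    (hμ0 : 0 < ‖μ 0‖) (hgap : ∀ k, M ≤ ‖μ (k + 1)‖ - ‖μ k‖)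
    (hgrow : ∀ k : ℕ, c * ‖μ k‖ ≤ (N + k) * (‖μ (k + 1)‖ - ‖μ k‖))
    (hdouble : ∀ k i, i < K * K → ‖μ (k + i)‖ ≤ 2 * ‖μ k‖) :
    ∃ (ι : Type) (n : ι → ℕ) (z : ι → ℂ), (∀ i, C ≤ ‖μ (n i) * z i‖) ∧
      (∀ i j, i ≠ j → D ≤ ‖μ (n i) * z i - μ (n j) * z j‖) ∧
      ∀ a : ℂ, r ≤ ‖a‖ → ∃ i, ‖μ (n i)‖ * ‖a - z i‖ < δ := by
  have hmono : StrictMono fun k => ‖μ k‖ :=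
    strictMono_nat_of_lt_succ fun k => by linarith [hgap k]
  have hpos : ∀ k, 0 < ‖μ k‖ := fun k => hμ0.trans_le (hmono.monotone k.zero_le)
  set L := K * K with hL
  have hL0 : 0 < L := Nat.mul_pos hK hK
  -- Chosen so that `hgrow` makes the scaled annulus width at most `r / 8` of the next gap
  -- (`hwidth`).
  set κ : ℝ := r * c / (8 * (N + L)) with hκ
  have hNL : (0 : ℝ) < N + L := by positivity
  have hκ0 : 0 < κ := by positivity
  set ρ : ℕ → ℝ := fun b => r + κ * ∑ i ∈ Finset.range b, 1 / ((i : ℝ) + 1) with hρ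
  have hρsucc : ∀ b, ρ (b + 1) = ρ b + κ / (b + 1) := by
    intro b
    simp only [hρ, Finset.sum_range_succ]
    ring
  have hρmono : Monotone ρ := monotone_nat_of_le_succ fun b => by
    rw [hρsucc]; have : 0 ≤ κ / ((b : ℝ) + 1) := by positivity
    linarith
  have hρ0 : ρ 0 = r := by simp [hρ]
  have hρr : ∀ b, r ≤ ρ b := fun b => hρ0 ▸ hρmono b.zero_le
  have hρtop : Tendsto ρ atTop atTop :=
    tendsto_atTop_add_const_left _ _
      (Real.tendsto_sum_range_one_div_nat_succ_atTop.const_mul_atTop hκ0)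
  -- The `4` absorbs the covering distance `2 * h b` and the doubling of `‖μ‖` within a block.
  set h : ℕ → ℝ := fun b => δ / (4 * ‖μ (b * L)‖) with hh
  have hh0 : ∀ b, 0 < h b := fun b => by have := hpos (b * L); positivity
  have hmesh_le : ∀ b i, i < L → ‖μ (b * L + i)‖ * (2 * h b) ≤ δ := by
    intro b i hi
    have h1 := hdouble (b * L) i hi
    have h2 := hpos (b * L)
    calc ‖μ (b * L + i)‖ * (2 * h b) ≤ (2 * ‖μ (b * L)‖) * (2 * h b) := by
          have := (hh0 b).le; gcongr
      _ = δ := by simp only [hh]; field_simp; norm_num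
  have hmesh_ge : ∀ b i, δ / 4 ≤ ‖μ (b * L + i)‖ * h b := by
    intro b i
    have h2 := hpos (b * L)
    calc δ / 4 = ‖μ (b * L)‖ * h b := by simp only [hh]; field_simp
      _ ≤ _ := by
        have := (hh0 b).le
        have := hmono.monotone (Nat.le_add_right (b * L) i)
        gcongr
  have hwidth : ∀ b i, i < L → ‖μ (b * L + i)‖ * (κ / (b + 1)) ≤
      r / 8 * (‖μ (b * L + i + 1)‖ - ‖μ (b * L + i)‖) := by
    intro b i hi
    set G := ‖μ (b * L + i + 1)‖ - ‖μ (b * L + i)‖ with hG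
    have hG0 : 0 < G := by linarith [hgap (b * L + i)]
    have h1 := hgrow (b * L + i)
    have h2 : (N : ℝ) + ((b * L + i : ℕ) : ℝ) ≤ (N + L) * (b + 1) := by
      have : N + (b * L + i) ≤ (N + L) * (b + 1) := by nlinarith [Nat.zero_le (N * b)]
      exact_mod_cast this
    have h3 : c * ‖μ (b * L + i)‖ ≤ (N + L) * (b + 1) * G :=
      h1.trans (mul_le_mul_of_nonneg_right h2 hG0.le)
    have hb : (0 : ℝ) < b + 1 := by positivity
    calc ‖μ (b * L + i)‖ * (κ / (b + 1))
        = r / 8 * (c * ‖μ (b * L + i)‖ / ((N + L) * (b + 1))) := by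
          simp only [hκ]; field_simp
      _ ≤ r / 8 * G := by
          gcongr
          rw [div_le_iff₀ (by positivity)]
          linarith
  -- The annulus is thickened by `2 * h` to retain the lattice point assigned to any `a` in it.
  refine ⟨{p : ℕ × ℤ × ℤ // ρ p.1 - 2 * h p.1 ≤ ‖latticePoint (h p.1) p.2.1 p.2.2‖ ∧
      ‖latticePoint (h p.1) p.2.1 p.2.2‖ ≤ ρ (p.1 + 1) + 2 * h p.1},
    fun p => p.1.1 * L + residueCode K p.1.2.1 p.1.2.2,
    fun p => latticePoint (h p.1.1) p.1.2.1 p.1.2.2, ?_, ?_, ?_⟩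
  · rintro ⟨⟨b, u, v⟩, hp1, hp2⟩
    simp only at hp1 hp2 ⊢
    set k := b * L + residueCode K u v with hk
    have h1 := hmesh_le b _ (residueCode_lt hK u v)
    have h2 : ‖μ 0‖ ≤ ‖μ k‖ := hmono.monotone k.zero_le
    rw [norm_mul]
    calc C ≤ ‖μ 0‖ * r - δ := by linarith
      _ ≤ ‖μ k‖ * ρ b - ‖μ k‖ * (2 * h b) := by
        have := mul_le_mul h2 (hρr b) hr.le (norm_nonneg _)
        linarith
      _ = ‖μ k‖ * (ρ b - 2 * h b) := by ring
      _ ≤ _ := by gcongr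
  · have hradial : ∀ b i b' i' (w w' : ℂ), i < L → i' < L → b * L + i < b' * L + i' →
        ‖w‖ ≤ ρ (b + 1) + 2 * h b → ρ b' - 2 * h b' ≤ ‖w'‖ →
        D ≤ ‖μ (b' * L + i') * w' - μ (b * L + i) * w‖ := by
      intro b i b' i' w w' hi hi' hlt hw hw'
      have hbb : b ≤ b' := by
        by_contra hcon
        have : (b' + 1) * L ≤ b * L := Nat.mul_le_mul_right L (by omega)
        rw [add_mul, one_mul] at this
        omega
      set y := ‖μ (b * L + i)‖ with hy
      set y' := ‖μ (b' * L + i')‖ with hy'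
      have h1 : ‖μ (b * L + i + 1)‖ ≤ y' := hmono.monotone hlt
      have h2 := hgap (b * L + i)
      have h3 := hwidth b i hi
      have h4 := hmesh_le b i hi
      have h5 := hmesh_le b' i' hi'
      have hy0 : 0 ≤ y := norm_nonneg _
      have hy0' : 0 ≤ y' := norm_nonneg _
      have h6 : y * ‖w‖ ≤ y * (ρ b + κ / (b + 1) + 2 * h b) := by
        rw [← hρsucc]; gcongr
      have h7 : y' * (ρ b - 2 * h b') ≤ y' * ‖w'‖ := by
        have := hρmono hbb
        gcongr
        linarith
      have h8 : (y' - y) * r ≤ (y' - y) * ρ b :=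
        mul_le_mul_of_nonneg_left (hρr b) (by linarith)
      have h9 : r / 8 * (‖μ (b * L + i + 1)‖ - y) ≤ r / 8 * (y' - y) := by gcongr
      have h10 : r * M ≤ r * (y' - y) := mul_le_mul_of_nonneg_left (by linarith) hr.le
      have h11 : 0 < r * (y' - y) := mul_pos hr (by linarith)
      -- The difference is at least `(7 / 8) * r * (y' - y) - 2 * δ`, while `r * (y' - y)` is at
      -- least `2 * (D + 2 * δ)`.
      have h12 : D ≤ y' * ‖w'‖ - y * ‖w‖ := by nlinarith
      calc D ≤ y' * ‖w'‖ - y * ‖w‖ := h12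
        _ = ‖μ (b' * L + i') * w'‖ - ‖μ (b * L + i) * w‖ := by rw [norm_mul, norm_mul]
        _ ≤ _ := norm_sub_norm_le _ _
    rintro ⟨⟨b, u, v⟩, hp1, hp2⟩ ⟨⟨b', u', v'⟩, hp1', hp2'⟩ hne
    simp only at hp1 hp2 hp1' hp2' ⊢
    have hi : residueCode K u v < L := residueCode_lt hK u v
    have hi' : residueCode K u' v' < L := residueCode_lt hK u' v'
    rcases lt_trichotomy (b * L + residueCode K u v) (b' * L + residueCode K u' v')
      with hlt | heq | hgt
    · rw [norm_sub_rev]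
      exact hradial _ _ _ _ _ _ hi hi' hlt hp2 hp1'
    · have hb : b = b' := by
        have := congrArg (· / L) heq
        simpa only [Nat.add_comm (_ * L), Nat.add_mul_div_right _ _ hL0,
          Nat.div_eq_of_lt hi, Nat.div_eq_of_lt hi', zero_add] using this
      subst hb
      obtain ⟨hu, hv⟩ := residueCode_inj hK (Nat.add_left_cancel heq)
      have huv : u ≠ u' ∨ v ≠ v' := by
        by_contra hcon
        push Not at hcon
        exact hne (by simp [hcon.1, hcon.2])
      rw [← heq, ← mul_sub, norm_mul]
      have h1 := le_norm_latticePoint_sub (hh0 b) hu hv huv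
      have h2 := hmesh_ge b (residueCode K u v)
      calc D ≤ δ / 4 * K := by linarith
        _ ≤ ‖μ (b * L + residueCode K u v)‖ * h b * K := by gcongr
        _ = ‖μ (b * L + residueCode K u v)‖ * (h b * K) := by ring
        _ ≤ _ := by gcongr
    · exact hradial _ _ _ _ _ _ hi' hi hgt hp2' hp1
  · intro a ha
    obtain ⟨b, hb1, hb2⟩ : ∃ b, ρ b ≤ ‖a‖ ∧ ‖a‖ < ρ (b + 1) := by
      have hex : ∃ b, ‖a‖ < ρ b := (hρtop.eventually_gt_atTop ‖a‖).exists
      classical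
      have h1 := Nat.find_spec hex
      obtain ⟨b, hb⟩ : ∃ b, Nat.find hex = b + 1 := by
        refine Nat.exists_eq_succ_of_ne_zero fun h0 => ?_
        rw [h0, hρ0] at h1
        linarith
      refine ⟨b, not_lt.1 (Nat.find_min hex (by omega)), hb ▸ h1⟩
    have hnear := norm_sub_latticePoint_floor_lt (hh0 b) a
    set u := ⌊a.re / h b⌋
    set v := ⌊a.im / h b⌋
    have h1 := norm_sub_norm_le a (latticePoint (h b) u v)
    have h2 := norm_sub_norm_le (latticePoint (h b) u v) a
    rw [norm_sub_rev] at h2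
    refine ⟨⟨(b, u, v), by simp only; linarith, by simp only; linarith⟩, ?_⟩
    have h3 := hmesh_le b _ (residueCode_lt hK u v)
    exact (mul_lt_mul_of_pos_left hnear (hpos _)).trans_le h3

theorem exists_separated_covering_centres {lam : ℕ → ℂ}
    (h1 : Tendsto (fun n : ℕ => ‖lam (n + 1)‖ - ‖lam n‖) atTop atTop)
    (h2 : Tendsto (fun n : ℕ => lam (n + 1) / lam n) atTop (𝓝 1))
    (h3 : 0 < liminf (fun n : ℕ => (((n : ℝ) * (‖lam (n + 1) / lam n‖ - 1) : ℝ) : EReal)) atTop)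
    {r δ : ℝ} (hr : 0 < r) (hδ : 0 < δ) (D C : ℝ) :
    ∃ (ι : Type) (n : ι → ℕ) (z : ι → ℂ), (∀ i, 1 ≤ n i) ∧ (∀ i, C ≤ ‖lam (n i) * z i‖) ∧
      (∀ i j, i ≠ j → D ≤ ‖lam (n i) * z i - lam (n j) * z j‖) ∧
      ∀ a : ℂ, r ≤ ‖a‖ → ∃ i, ‖lam (n i)‖ * ‖a - z i‖ < δ := by
  obtain ⟨K, hK⟩ := exists_nat_gt (max 0 (4 * D / δ))
  have hK0 : 0 < K := by
    have := (le_max_left _ _).trans_lt hK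
    exact_mod_cast this
  have hKD : 4 * D ≤ δ * K := by
    have := (le_max_right _ _).trans hK.le
    rw [div_le_iff₀ hδ] at this
    linarith
  set M : ℝ := max 1 (2 * (D + 2 * δ) / r) with hM
  have hM1 : 1 ≤ M := le_max_left _ _
  have hMD : 2 * (D + 2 * δ) ≤ r * M := by
    have := le_max_right 1 (2 * (D + 2 * δ) / r)
    rw [div_le_iff₀ hr] at this
    linarith
  obtain ⟨c, hc, hc'⟩ := EReal.lt_iff_exists_real_btwn.1 h3
  have hc0 : 0 < c := by exact_mod_cast hc
  have e1 := h1.eventually_ge_atTop M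
  have e3 : ∀ᶠ n : ℕ in atTop, c < (n : ℝ) * (‖lam (n + 1) / lam n‖ - 1) :=
    (eventually_lt_of_lt_liminf hc').mono fun n hn => by exact_mod_cast hn
  have etop : Tendsto (fun n => ‖lam n‖) atTop atTop := by
    obtain ⟨N, hN⟩ := eventually_atTop.1 e1
    have hlin : ∀ k : ℕ, (k : ℝ) ≤ ‖lam (k + N)‖ := by
      intro k
      induction k with
      | zero => simp
      | succ k ih =>
        have := hN (k + N) (by omega)
        rw [show k + 1 + N = k + N + 1 by ring]
        push_cast
        linarith
    exact (tendsto_add_atTop_iff_nat N).1 (tendsto_atTop_mono hlin tendsto_natCast_atTop_atTop)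
  have e2 : ∀ i : ℕ, ∀ᶠ n : ℕ in atTop, ‖lam (n + i)‖ ≤ 2 * ‖lam n‖ := by
    intro i
    have hlim : Tendsto (fun n => lam (n + i) / lam n) atTop (𝓝 1) := by
      induction i with
      | zero =>
        refine tendsto_const_nhds.congr' ?_
        filter_upwards [etop.eventually_gt_atTop 0] with n hn
        rw [add_zero, div_self (norm_pos_iff.1 hn)]
      | succ i ih =>
        have := (h2.comp (tendsto_add_atTop_nat i)).mul ih
        rw [one_mul] at this
        refine this.congr' ?_
        filter_upwards [(etop.comp (tendsto_add_atTop_nat i)).eventually_gt_atTop 0] with n hn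
        exact div_mul_div_cancel₀ (norm_pos_iff.1 hn)
    have hlim' := hlim.norm
    rw [norm_one] at hlim'
    filter_upwards [hlim'.eventually_lt_const one_lt_two, etop.eventually_gt_atTop 0]
      with n hn hn0
    rw [norm_div, div_lt_iff₀ hn0] at hn
    exact hn.le
  have e2' : ∀ᶠ n : ℕ in atTop, ∀ i ∈ Set.Iio (K * K), ‖lam (n + i)‖ ≤ 2 * ‖lam n‖ :=
    (eventually_all_finite (Set.finite_Iio _)).2 fun i _ => e2 i
  obtain ⟨N, hN⟩ := eventually_atTop.1 (e1.and (e3.and (e2'.and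
    ((etop.eventually_gt_atTop 0).and (etop.eventually_ge_atTop ((C + δ) / r))))))
  -- Starting at `N + 1` keeps every index at least `1`, and the factor `n` in the liminf becomes
  -- `(N + 1) + k`, as `hgrow` requires.
  have hN' : ∀ k, _ := fun k => hN (N + 1 + k) (by omega)
  obtain ⟨ι, n, z, hz1, hz2, hz3⟩ := exists_separated_covering_centres_of_forall
    (μ := fun k => lam (N + 1 + k)) (N := N + 1) (C := C) hK0 N.succ_pos hc0 hr hδ
    (one_pos.trans_le hM1) hKD hMD
    ((div_le_iff₀ hr).1 (hN' 0).2.2.2.2) (hN' 0).2.2.2.1 (fun k => (hN' k).1)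
    (fun k => by
      have hk := (hN' k).2.1
      have hk0 := (hN' k).2.2.2.1
      have hmul := mul_le_mul_of_nonneg_right hk.le hk0.le
      rw [norm_div] at hmul
      push_cast at hmul ⊢
      rw [mul_assoc, sub_mul, div_mul_cancel₀ _ hk0.ne', one_mul] at hmul
      exact hmul)
    (fun k i hi => by
      have := (hN' k).2.2.1 i hi
      rwa [add_assoc] at this)
  exact ⟨ι, fun i => N + 1 + n i, z, fun i => by simp only; omega, hz1, hz2, hz3⟩

/-! ### Entire functions as a Baire space; reduction to open sets -/

theorem isClosed_entireSubmodule : IsClosed (entireSubmodule : Set C(ℂ, ℂ)) := by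
  refine isClosed_of_closure_subset fun f hf => ?_
  have : (𝓝[(entireSubmodule : Set C(ℂ, ℂ))] f).NeBot := mem_closure_iff_nhdsWithin_neBot.1 hf
  have hlim : Tendsto (fun g : C(ℂ, ℂ) => g) (𝓝[(entireSubmodule : Set C(ℂ, ℂ))] f) (𝓝 f) :=
    tendsto_id.mono_left nhdsWithin_le_nhds
  rw [ContinuousMap.tendsto_iff_tendstoLocallyUniformly] at hlim
  have hd := (tendstoLocallyUniformlyOn_univ.2 hlim).differentiableOn
    (eventually_mem_nhdsWithin.mono fun g hg => Differentiable.differentiableOn hg) isOpen_univ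
  exact differentiableOn_univ.1 hd

instance : BaireSpace EntireFunctions := by
  have : CompleteSpace EntireFunctions := isClosed_entireSubmodule.completeSpace_coe
  have : (uniformity EntireFunctions).IsCountablyGenerated :=
    inferInstanceAs (comap _ (uniformity C(ℂ, ℂ))).IsCountablyGenerated
  infer_instance

instance : SecondCountableTopology EntireFunctions :=
  IsInducing.subtypeVal.secondCountableTopology

theorem exists_setOf_near_subset {U : Set EntireFunctions} (hU : IsOpen U) {g : EntireFunctions}
    (hg : g ∈ U) : ∃ k > 0, ∃ ε > 0, ∀ f : EntireFunctions,
      (∀ z : ℂ, ‖z‖ ≤ k → ‖f.1 z - g.1 z‖ < ε) → f ∈ U := by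
  have hnhds : U ∈ comap Subtype.val (𝓝 g.1) := by
    rw [← nhds_induced]; exact hU.mem_nhds hg
  obtain ⟨V, hV, hVU⟩ := hnhds
  obtain ⟨⟨K, ε⟩, ⟨hK, hε⟩, hKε⟩ := (nhds_basis_uniformity'
    (Metric.uniformity_basis_dist.compactConvergenceUniformity (α := ℂ))).mem_iff.1 hV
  obtain ⟨k, hk, hKk⟩ := hK.isBounded.exists_pos_norm_le
  refine ⟨k, hk, ε, hε, fun f hf => hVU (hKε fun z hz => ?_)⟩
  have := hf z (hKk z hz)
  rwa [norm_sub_rev, ← dist_eq_norm] at this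

theorem continuous_translationOp_uncurry :
    Continuous fun p : EntireFunctions × ℂ => translationOp p.2 p.1 := by
  refine Continuous.subtype_mk ?_ _
  refine Continuous.compCM (continuous_subtype_val.comp continuous_fst) ?_
  exact ContinuousMap.continuous_of_continuous_uncurry _ (by
    simp only [Function.uncurry_def, ContinuousMap.coe_mk]; fun_prop)

/-- Entire functions having, for each parameter `a ∈ S`, some `lam n * a`-translate in `U`. -/
def translatesMeet (lam : ℕ → ℂ) (S : Set ℂ) (U : Set EntireFunctions) : Set EntireFunctions :=
  {f | ∀ a ∈ S, ∃ n : ℕ, 1 ≤ n ∧ translationOp (lam n * a) f ∈ U}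

/-- Tube lemma: translation is jointly continuous in function and parameter, so an `n` good for `(f,
a)` stays good nearby, and compactness gives one neighbourhood of `f` for all `a`. -/
theorem isOpen_translatesMeet (lam : ℕ → ℂ) {S : Set ℂ} (hS : IsCompact S)
    {U : Set EntireFunctions} (hU : IsOpen U) : IsOpen (translatesMeet lam S U) := by
  rw [isOpen_iff_mem_nhds]
  intro f hf
  refine hS.eventually_forall_of_forall_eventually fun a ha => ?_
  obtain ⟨n, hn, hfn⟩ := hf a ha
  have hcont : Continuous fun p : EntireFunctions × ℂ => translationOp (lam n * p.2) p.1 :=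
    continuous_translationOp_uncurry.comp
      (continuous_fst.prodMk (continuous_const.mul continuous_snd))
  filter_upwards [hcont.continuousAt.eventually_mem (hU.mem_nhds hfn)] with p hp
  exact ⟨n, hn, hp⟩

theorem iInter_HC_translationOp_eq (lam : ℕ → ℂ) (S : Set ℂ) {B : Set (Set EntireFunctions)}
    (hB : TopologicalSpace.IsTopologicalBasis B) (hB0 : ∅ ∉ B) :
    ⋂ a ∈ S, HC (fun n : ℕ => translationOp (lam n * a)) = ⋂ U ∈ B, translatesMeet lam S U := by
  ext f
  simp only [Set.mem_iInter, HC, translatesMeet, Set.mem_ofPred_eq, hB.dense_iff]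
  constructor
  · intro h U hU a ha
    obtain ⟨_, hgU, n, hn, rfl⟩ := h a ha U hU
      (Set.nonempty_iff_ne_empty.2 fun h0 => hB0 (h0 ▸ hU))
    exact ⟨n, hn, hgU⟩
  · intro h a ha U hU _
    obtain ⟨n, hn, hf⟩ := h U hU a ha
    exact ⟨_, hf, n, hn, rfl⟩

/-! ### The sector, density, and conclusion -/

theorem isCompact_sector (r₀ R₀ θ₀ θT : ℝ) : IsCompact (sector r₀ R₀ θ₀ θT) := by
  have h : sector r₀ R₀ θ₀ θT =
      (fun p : ℝ × ℝ => (p.1 : ℂ) * Complex.exp (2 * (Real.pi : ℂ) * Complex.I * (p.2 : ℂ))) ''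
        (Set.Icc r₀ R₀ ×ˢ Set.Icc θ₀ θT) := by
    ext a
    constructor
    · rintro ⟨r, hr, t, ht, rfl⟩
      exact ⟨(r, t), ⟨hr, ht⟩, rfl⟩
    · rintro ⟨⟨r, t⟩, ⟨hr, ht⟩, rfl⟩
      exact ⟨r, hr, t, ht, rfl⟩
  rw [h]
  exact (isCompact_Icc.prod isCompact_Icc).image (by fun_prop)

theorem le_norm_of_mem_sector {r₀ R₀ θ₀ θT : ℝ} (hr₀ : 0 < r₀) {a : ℂ}
    (ha : a ∈ sector r₀ R₀ θ₀ θT) : r₀ ≤ ‖a‖ := by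
  obtain ⟨r, hr, t, -, rfl⟩ := ha
  have : ‖Complex.exp (2 * (Real.pi : ℂ) * Complex.I * (t : ℂ))‖ = 1 := by
    rw [show 2 * (Real.pi : ℂ) * Complex.I * (t : ℂ) = ((2 * Real.pi * t : ℝ) : ℂ) * Complex.I by
      push_cast; ring]
    exact Complex.norm_exp_ofReal_mul_I _
  rw [norm_mul, this, mul_one, Complex.norm_real, Real.norm_eq_abs,
    abs_of_pos (hr₀.trans_le hr.1)]
  exact hr.1

theorem dense_translatesMeet {lam : ℕ → ℂ}
    (h1 : Tendsto (fun n : ℕ => ‖lam (n + 1)‖ - ‖lam n‖) atTop atTop)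
    (h2 : Tendsto (fun n : ℕ => lam (n + 1) / lam n) atTop (𝓝 1))
    (h3 : 0 < liminf (fun n : ℕ => (((n : ℝ) * (‖lam (n + 1) / lam n‖ - 1) : ℝ) : EReal)) atTop)
    {S : Set ℂ} (hS : IsCompact S) {r : ℝ} (hr : 0 < r) (hSr : ∀ a ∈ S, r ≤ ‖a‖)
    {U : Set EntireFunctions} (hU : IsOpen U) (hU0 : U.Nonempty) :
    Dense (translatesMeet lam S U) := by
  rw [dense_iff_inter_open]
  rintro W hW ⟨g₀, hg₀⟩
  obtain ⟨g, hg⟩ := hU0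
  obtain ⟨C, hC, ε₀, hε₀, hnear₀⟩ := exists_setOf_near_subset hW hg₀
  obtain ⟨k, hk, ε, hε, hnear⟩ := exists_setOf_near_subset hU hg
  have huc := (isCompact_closedBall (0 : ℂ) (k + 1)).uniformContinuousOn_of_continuous
    g.1.continuous.continuousOn
  obtain ⟨δ', hδ', hg_uc⟩ := Metric.uniformContinuousOn_iff.1 huc (ε / 2) (half_pos hε)
  set δ := min δ' 1 with hδ
  have hδ0 : 0 < δ := lt_min hδ' one_pos
  -- The discs will have radius `k + 1`, leaving room for a shift by `δ ≤ 1`, and must avoid each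
  -- other and the disc of radius `C` about `0`; the extra `1` makes the inequalities strict.
  obtain ⟨ι, n, c, hn, hfar, hsep, hcover⟩ := exists_separated_covering_centres h1 h2 h3 hr hδ0
    (2 * (k + 1) + 1) (C + (k + 1) + 1)
  obtain ⟨t, ht⟩ := hS.elim_finite_subcover (fun i => {a : ℂ | ‖lam (n i)‖ * ‖a - c i‖ < δ})
    (fun i => isOpen_lt (by fun_prop) continuous_const)
    (fun a ha => Set.mem_iUnion.2 (hcover a (hSr a ha)))
  -- `none` indexes the disc about `0`, where `g₀` is approximated.
  let w : Option t → ℂ := fun o => o.elim 0 fun i => lam (n i) * c i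
  let ρ : Option t → ℝ := fun o => o.elim C fun _ => k + 1
  let target : Option t → ℂ → ℂ := fun o => o.elim g₀.1 fun i z => g.1 (z - lam (n i) * c i)
  obtain ⟨f, hf, hfnear⟩ := exists_entire_near_on_discs (w := w) (ρ := ρ)
    (by rintro (_ | i) <;> simp only [ρ, Option.elim] <;> linarith)
    (by
      rintro (_ | i) (_ | j) hij
      · exact absurd rfl hij
      · simp only [w, ρ, Option.elim, zero_sub, norm_neg]
        linarith [hfar j]
      · simp only [w, ρ, Option.elim, sub_zero]
        linarith [hfar i]
      · have hij' : (i : ι) ≠ j := fun h => hij (congrArg some (Subtype.ext h))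
        simp only [w, ρ, Option.elim]
        linarith [hsep i j hij'])
    target
    (by
      rintro (_ | i)
      · exact g₀.2
      · exact Differentiable.comp (g := (g.1 : ℂ → ℂ)) g.2 (differentiable_id.sub_const _))
    (lt_min hε₀ (half_pos hε))
  let F : EntireFunctions := ⟨⟨f, hf.continuous⟩, hf⟩
  refine ⟨F, hnear₀ F fun z hz => ?_, fun a ha => ?_⟩
  · exact (hfnear none z (by simpa [w, ρ] using hz)).trans_le (min_le_left _ _)
  · obtain ⟨i, hit, hia⟩ := Set.mem_iUnion₂.1 (ht ha)
    refine ⟨n i, hn i, hnear _ fun z hz => ?_⟩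
    have hd : ‖lam (n i) * a - lam (n i) * c i‖ < δ := by
      rw [← mul_sub, norm_mul]; exact hia
    -- `y` is `z + lam (n i) * a` measured from the disc's centre: there `f` is near `g y`, and `y`
    -- is within `δ` of `z`.
    set y := z + (lam (n i) * a - lam (n i) * c i) with hy
    have hyz : dist y z < δ := by rw [dist_eq_norm, hy, add_sub_cancel_left]; exact hd
    have hyk : ‖y‖ ≤ k + 1 := by
      have := norm_add_le z (lam (n i) * a - lam (n i) * c i)
      have := min_le_right δ' 1
      linarith
    have e1 : ‖f (z + lam (n i) * a) - g.1 y‖ < ε / 2 := by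
      have := hfnear (some ⟨i, hit⟩) (z + lam (n i) * a) (by
        simp only [w, ρ, Option.elim, mem_closedBall_iff_norm]
        rwa [add_sub_assoc])
      simp only [target, Option.elim, add_sub_assoc] at this
      exact this.trans_le (min_le_right _ _)
    have e2 : ‖g.1 y - g.1 z‖ < ε / 2 := by
      rw [← dist_eq_norm]
      exact hg_uc y (by simpa using hyk) z (by simpa using by linarith)
        (hyz.trans_le (min_le_left _ _))
    calc ‖f (z + lam (n i) * a) - g.1 z‖
        = ‖(f (z + lam (n i) * a) - g.1 y) + (g.1 y - g.1 z)‖ := by rw [sub_add_sub_cancel]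
      _ ≤ _ := norm_add_le _ _
      _ < ε := by linarith

theorem proposition1 (lam : ℕ → ℂ) (hne : ∀ n : ℕ, 1 ≤ n → lam n ≠ 0)
    (h1 : Tendsto (fun n : ℕ => ‖lam (n + 1)‖ - ‖lam n‖) atTop atTop)
    (h2 : Tendsto (fun n : ℕ => lam (n + 1) / lam n) atTop (𝓝 1))
    (h3 : 0 < liminf (fun n : ℕ => (((n : ℝ) * (‖lam (n + 1) / lam n‖ - 1) : ℝ) : EReal)) atTop)
    (r₀ R₀ θ₀ θT : ℝ) (hr₀ : 0 < r₀) (hr₀1 : r₀ < 1) (hR₀ : 1 < R₀)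
    (hθ₀ : 0 ≤ θ₀) (hθ : θ₀ < θT) (hθT : θT ≤ 1) (hdiff : θT - θ₀ = 1 / 4) :
    IsGδ (⋂ a ∈ sector r₀ R₀ θ₀ θT, HC (fun n : ℕ => translationOp (lam n * a))) ∧
      Dense (⋂ a ∈ sector r₀ R₀ θ₀ θT, HC (fun n : ℕ => translationOp (lam n * a))) := by
  obtain ⟨B, hBc, hB0, hB⟩ := TopologicalSpace.exists_countable_basis EntireFunctions
  have hS := isCompact_sector r₀ R₀ θ₀ θT
  have hopen : ∀ U ∈ B, IsOpen (translatesMeet lam (sector r₀ R₀ θ₀ θT) U) := fun U hU =>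
    isOpen_translatesMeet lam hS (hB.isOpen hU)
  rw [iInter_HC_translationOp_eq lam _ hB hB0]
  refine ⟨IsGδ.biInter hBc fun U hU => (hopen U hU).isGδ, dense_biInter_of_isOpen hopen hBc ?_⟩
  intro U hU
  exact dense_translatesMeet h1 h2 h3 hS hr₀ (fun a ha => le_norm_of_mem_sector hr₀ ha)
    (hB.isOpen hU) (Set.nonempty_iff_ne_empty.2 fun h0 => hB0 (h0 ▸ hU))
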